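/- There is an absolute constant $C>0$ such that the following holds. Let $n\ge 2$, let $\mu$ be a Borel probability measure on $\mathbb{R}^2$ whose support is contained in $[0,1]^2$, let $X_1,\dots,X_n$ be i.i.d. random vectors with law $\mu$ defined on some probability space, and let $\mu_n=\frac1n\sum_{i=1}^n\delta_{X_i}$ be the empirical measure. Then $$\mathbb{E}\,W_1(\mu_n,\mu)\;\le\; C\sqrt{\frac{\log n}{n}}\,,$$ where $W_1(\mu,\nu)=\inf_{\gamma}\int\|x-y\|\,\gamma(\mathrm{d}x,\mathrm{d}y)$ is the $1$-Wasserstein distance, the infimum being over all couplings $\gamma$ of $\mu$ and $\nu$ (probability measures on $\mathbb{R}^2\times\mathbb{R}^2$ with marginals $\mu$ and $\nu$) and $\|\cdot\|$ the Euclidean norm. (In particular $W_1(\mu_n,\mu)$ is measurable with respect to the completed probability space, so that its expectation makes sense.) -/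

import Mathlib

open MeasureTheory ProbabilityTheory
open scoped ENNReal

/-- The Euclidean plane `ℝ²` (with the Euclidean norm). -/
abbrev Plane : Type := EuclideanSpace ℝ (Fin 2)

/-- The closed unit square `[0, 1]²`. -/
def unitSquare : Set Plane := {x | ∀ i, x i ∈ Set.Icc (0 : ℝ) 1}

/-- The set of couplings of `μ` and `ν`: measures on the product space whose first marginal is `μ`
and whose second marginal is `ν`. -/
def couplings {E : Type*} [MeasurableSpace E] (μ ν : Measure E) : Set (Measure (E × E)) :=
  {γ | γ.fst = μ ∧ γ.snd = ν}

/-- The `1`-Wasserstein distance, with values in `[0, ∞]`: the infimum over all couplings `γ` of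
the transport cost `∫ d(x, y) γ(dx, dy)`. -/
noncomputable def wasserstein1 {E : Type*} [PseudoEMetricSpace E] [MeasurableSpace E]
    (μ ν : Measure E) : ℝ≥0∞ :=
  ⨅ γ ∈ couplings μ ν, ∫⁻ z, edist z.1 z.2 ∂γ

/-- The empirical measure `(1/n) ∑ᵢ δ_{xᵢ}` of the points `x₁, …, xₙ`. -/
noncomputable def empiricalMeasure {E : Type*} [MeasurableSpace E] {n : ℕ} (x : Fin n → E) :
    Measure E :=
  (n : ℝ≥0∞)⁻¹ • ∑ i, Measure.dirac (x i)

/-! Cut the square into cells of side `1/N`. Transport between cell laws is dual to testing against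
Lipschitz functions, and a Lipschitz function has bounded Dirichlet energy, so its pairing with the
difference of two laws is controlled by a discrete `H⁻¹` norm, computed by Fourier series on a torus
(`sq_sum_mul_le_of_diff_le`, `wasserstein1_le_sqrt_cellEnergy`).

Each Fourier coefficient of `μ_n - μ` is a centred average of `n` i.i.d. variables of modulus at
most 2, with mean square at most `1/n` whatever `μ` is. The expected squared norm is thus at most
`1/n` times the trace of the inverse Laplacian; in dimension two that trace is a sum of `1/|m|²`
over a planar box, the source of the logarithm (`sum_inv_torusEigenvalue_le`).

This gives `E W₁ ≤ √(2(5 + 3 log N)/n) + 2/N` (`lintegral_wasserstein1_le`), and `N ≈ √n` makes the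
mesh error harmless. -/

/-! ### Finite Kantorovich duality and lifting of discrete couplings. -/

/-- Kantorovich duality on a finite set: if every `d`-Lipschitz function has mean difference at most
`c` between `p` and `q`, then there is a coupling of cost at most `c`. -/
theorem exists_coupling_of_lipschitz_sum_le {A : Type*} [Fintype A] [DecidableEq A] [Nonempty A]
    (d : A → A → ℝ) (d_self : ∀ a, d a a = 0) (d_tri : ∀ a b c, d a c ≤ d a b + d b c)
    (p q : A → ℝ) (hp : ∀ a, 0 ≤ p a) (hq : ∀ a, 0 ≤ q a) (hp1 : ∑ a, p a = 1)
    (hq1 : ∑ a, q a = 1) (c : ℝ)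
    (h : ∀ f : A → ℝ, (∀ a b, f a - f b ≤ d a b) → ∑ a, f a * (p a - q a) ≤ c) :
    ∃ π : A × A → ℝ, (∀ z, 0 ≤ π z) ∧ (∀ a, ∑ b, π (a, b) = p a) ∧ (∀ b, ∑ a, π (a, b) = q b) ∧
      ∑ z, π z * d z.1 z.2 ≤ c := by
  -- `Φ` sends a plan to its marginals and cost; a good coupling exists iff the image of the simplex
  -- meets `{p} × {q} × (-∞, c]`. Otherwise the two convex sets are strictly separated.
  let Φ : (A × A → ℝ) →ₗ[ℝ] (A → ℝ) × (A → ℝ) × ℝ :=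
    { toFun := fun π => (fun a => ∑ b, π (a, b), fun b => ∑ a, π (a, b), ∑ z, π z * d z.1 z.2)
      map_add' := fun x y => by
        ext <;> simp [Finset.sum_add_distrib, add_mul]
      map_smul' := fun r x => by
        ext <;> simp [Finset.mul_sum, mul_assoc] }
  have hΦc : Continuous Φ := Φ.continuous_of_finiteDimensional
  by_contra hcon
  let s : Set ((A → ℝ) × (A → ℝ) × ℝ) := Φ '' stdSimplex ℝ (A × A)
  let t : Set ((A → ℝ) × (A → ℝ) × ℝ) := {p} ×ˢ ({q} ×ˢ Set.Iic c)
  have hdisj : Disjoint s t := by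
    rw [Set.disjoint_left]
    rintro _ ⟨π, hπ, rfl⟩ ⟨h1, h2, h3⟩
    exact hcon ⟨π, hπ.1, fun a => congrFun h1 a, fun b => congrFun h2 b, h3⟩
  obtain ⟨g, u, v, hs, huv, ht⟩ := geometric_hahn_banach_compact_closed
    ((convex_stdSimplex ℝ (A × A)).linear_image Φ) ((isCompact_stdSimplex ℝ (A × A)).image hΦc)
    ((convex_singleton p).prod ((convex_singleton q).prod (convex_Iic c)))
    (isClosed_singleton.prod (isClosed_singleton.prod isClosed_Iic)) hdisj
  -- The coordinates of the separating functional are a pair of dual potentials and the multiplier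
  -- `r` of the cost.
  let φ : A → ℝ := fun a => g (Pi.single a 1, 0, 0)
  let ψ : A → ℝ := fun b => g (0, Pi.single b 1, 0)
  let r : ℝ := g (0, 0, 1)
  have hg : ∀ x y z, g (x, y, z) = ∑ a, φ a * x a + ∑ b, ψ b * y b + r * z := by
    intro x y z
    have hx : x = ∑ a, x a • (Pi.single a 1 : A → ℝ) := by
      ext b; simp [Finset.sum_apply, Pi.single_apply]
    have hy : y = ∑ a, y a • (Pi.single a 1 : A → ℝ) := by
      ext b; simp [Finset.sum_apply, Pi.single_apply]
    have e : (x, y, z) = ∑ a, x a • ((Pi.single a 1, 0, 0) : (A → ℝ) × (A → ℝ) × ℝ)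
        + ∑ a, y a • ((0, Pi.single a 1, 0) : (A → ℝ) × (A → ℝ) × ℝ) + z • (0, 0, 1) := by
      refine Prod.ext ?_ (Prod.ext ?_ ?_)
      · simpa [Prod.fst_sum, Prod.snd_sum] using hx
      · simpa [Prod.fst_sum, Prod.snd_sum] using hy
      · simp [Prod.snd_sum]
    rw [e]
    simp only [map_add, map_sum, map_smul, smul_eq_mul, φ, ψ, r]
    congr 1
    · congr 1 <;> exact Finset.sum_congr rfl fun _ _ => mul_comm _ _
    · ring
  have hpt : ∀ a b, φ a + ψ b + r * d a b < u := by
    intro a b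
    have := hs _ ⟨Pi.single (a, b) 1, single_mem_stdSimplex ℝ (a, b), rfl⟩
    have e : Φ (Pi.single (a, b) 1) = (Pi.single a 1, Pi.single b 1, d a b) := by
      refine Prod.ext ?_ (Prod.ext ?_ ?_)
      · ext x
        by_cases hx : x = a <;> simp [Φ, Pi.single_apply, hx, Prod.ext_iff, Finset.filter_eq']
      · ext x
        by_cases hx : x = b <;> simp [Φ, Pi.single_apply, hx, Prod.ext_iff, Finset.filter_eq']
      · simp [Φ, Pi.single_apply]
    rw [e, hg] at this
    simpa [Pi.single_apply] using this
  have hval : ∀ x ≤ c, v < ∑ a, φ a * p a + ∑ b, ψ b * q b + r * x := by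
    intro x hx
    have := ht (p, q, x) ⟨rfl, rfl, hx⟩
    rwa [hg] at this
  set S := ∑ a, φ a * p a + ∑ b, ψ b * q b with hS
  -- The cost coordinate is unbounded below, so `r > 0` would break the lower bound `v`; the chosen
  -- cost brings the value down to at most `v`.
  have hr0 : r ≤ 0 := by
    by_contra! hr
    have h1 := hval (min c ((v - S) / r)) (min_le_left _ _)
    have h2 : r * min c ((v - S) / r) ≤ r * ((v - S) / r) :=
      mul_le_mul_of_nonneg_left (min_le_right _ _) hr.le
    rw [mul_div_cancel₀ _ hr.ne'] at h2
    linarith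
  -- If `r = 0`, averaging `φ + ψ < u` over the product coupling of `p` and `q` contradicts `u < v`.
  have hr : r < 0 := by
    refine lt_of_le_of_ne hr0 fun hr => ?_
    have h1 := hval c le_rfl
    have h2 : S ≤ u := by
      have : S = ∑ a, ∑ b, (φ a + ψ b) * (p a * q b) := by
        have e1 : ∀ a, ∑ b, (φ a + ψ b) * (p a * q b)
            = φ a * p a * ∑ b, q b + p a * ∑ b, ψ b * q b := by
          intro a
          rw [Finset.mul_sum, Finset.mul_sum, ← Finset.sum_add_distrib]
          exact Finset.sum_congr rfl fun _ _ => by ring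
        simp_rw [e1, Finset.sum_add_distrib, hq1, ← Finset.sum_mul, hp1]
        simp [hS]
      rw [this]
      calc ∑ a, ∑ b, (φ a + ψ b) * (p a * q b) ≤ ∑ a, ∑ b, u * (p a * q b) := by
            refine Finset.sum_le_sum fun a _ => Finset.sum_le_sum fun b _ => ?_
            have := hpt a b
            rw [hr, zero_mul, add_zero] at this
            exact mul_le_mul_of_nonneg_right this.le (mul_nonneg (hp a) (hq b))
        _ = u := by simp_rw [← Finset.mul_sum, hq1, mul_one, hp1, mul_one]
    rw [hr, zero_mul] at h1
    linarith
  set k : ℝ := -r with hk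
  have hk0 : 0 < k := by linarith
  -- The `d`-transform of `ψ / k`: the triangle inequality makes it Lipschitz, and this one function
  -- dominates both potentials, since `φ ≤ k f + u` and `ψ ≤ -k f`.
  let f : A → ℝ := fun a => Finset.univ.inf' Finset.univ_nonempty fun b => d a b - ψ b / k
  have hf_lip : ∀ a b, f a - f b ≤ d a b := by
    intro a b
    obtain ⟨x, -, hx⟩ := Finset.exists_mem_eq_inf' (Finset.univ_nonempty (α := A))
      (fun x => d b x - ψ x / k)
    have h1 : f a ≤ d a x - ψ x / k := Finset.inf'_le _ (Finset.mem_univ x)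
    have h2 : f b = d b x - ψ x / k := hx
    have := d_tri a b x
    linarith
  have hf1 : ∀ a, φ a ≤ k * f a + u := by
    intro a
    obtain ⟨x, -, hx⟩ := Finset.exists_mem_eq_inf' (Finset.univ_nonempty (α := A))
      (fun x => d a x - ψ x / k)
    have h2 : f a = d a x - ψ x / k := hx
    have h3 := hpt a x
    rw [h2, mul_sub, mul_div_cancel₀ _ hk0.ne']
    have : r = -k := by rw [hk, neg_neg]
    rw [this] at h3
    linarith
  have hf2 : ∀ b, ψ b ≤ - (k * f b) := by
    intro b
    have h1 : f b ≤ d b b - ψ b / k := Finset.inf'_le _ (Finset.mem_univ b)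
    rw [d_self, zero_sub] at h1
    have := mul_le_mul_of_nonneg_left h1 hk0.le
    rw [mul_neg, mul_div_cancel₀ _ hk0.ne'] at this
    linarith
  have h1 : ∑ a, φ a * p a ≤ k * ∑ a, f a * p a + u := by
    calc ∑ a, φ a * p a ≤ ∑ a, (k * f a + u) * p a :=
          Finset.sum_le_sum fun a _ => mul_le_mul_of_nonneg_right (hf1 a) (hp a)
      _ = _ := by
        simp_rw [add_mul, Finset.sum_add_distrib, ← Finset.mul_sum, hp1, mul_assoc,
          ← Finset.mul_sum, mul_one]
  have h2 : ∑ b, ψ b * q b ≤ - (k * ∑ a, f a * q a) := by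
    calc ∑ a, ψ a * q a ≤ ∑ a, -(k * f a) * q a :=
          Finset.sum_le_sum fun a _ => mul_le_mul_of_nonneg_right (hf2 a) (hq a)
      _ = _ := by
        simp_rw [neg_mul, mul_assoc, Finset.sum_neg_distrib, ← Finset.mul_sum]
  have h3 := hval c le_rfl
  have h4 := mul_le_mul_of_nonneg_left (h f hf_lip) hk0.le
  simp_rw [mul_sub, Finset.sum_sub_distrib] at h4
  rw [mul_sub] at h4
  have : r = -k := by rw [hk, neg_neg]
  rw [this] at h3
  linarith

/-- A coupling of the laws of the cells of a finite measurable partition lifts to a coupling of the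
measures themselves. -/
theorem wasserstein1_le_of_discrete_coupling {E A : Type*} [PseudoEMetricSpace E] [MeasurableSpace E]
    [Fintype A] [MeasurableSpace A] [DiscreteMeasurableSpace A]
    (μ ν : Measure E) [IsProbabilityMeasure μ] [IsProbabilityMeasure ν]
    {T : E → A} (hT : Measurable T) {S : Set E} (hμS : ∀ᵐ x ∂μ, x ∈ S) (hνS : ∀ᵐ x ∂ν, x ∈ S)
    (D : A → A → ℝ≥0∞) (hD : ∀ x ∈ S, ∀ y ∈ S, edist x y ≤ D (T x) (T y))
    (π : A → A → ℝ≥0∞) (hπ1 : ∀ a, ∑ b, π a b = μ (T ⁻¹' {a}))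
    (hπ2 : ∀ b, ∑ a, π a b = ν (T ⁻¹' {b})) :
    wasserstein1 μ ν ≤ ∑ a, ∑ b, π a b * D a b := by
  -- Within each pair of cells, mass is transported by the product of the conditional laws. These
  -- are probability measures only on cells of positive mass, but `π a b` vanishes on the others.
  let γ : Measure (E × E) :=
    ∑ a, ∑ b, π a b • (μ[|T ⁻¹' {a}]).prod (ν[|T ⁻¹' {b}])
  have hm : ∀ a, MeasurableSet (T ⁻¹' {a}) := fun a => hT (measurableSet_singleton a)
  have hμ : ∀ a b, π a b ≠ 0 → μ (T ⁻¹' {a}) ≠ 0 := by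
    intro a b hab h0
    rw [← hπ1] at h0
    exact hab ((Finset.sum_eq_zero_iff.mp h0) b (Finset.mem_univ b))
  have hν : ∀ a b, π a b ≠ 0 → ν (T ⁻¹' {b}) ≠ 0 := by
    intro a b hab h0
    rw [← hπ2] at h0
    exact hab ((Finset.sum_eq_zero_iff.mp h0) a (Finset.mem_univ a))
  have hγ : γ ∈ couplings μ ν := by
    constructor
    · conv_rhs => rw [← sum_meas_smul_cond_fiber hT μ]
      simp only [γ, Measure.fst, ← Measure.mapₗ_apply_of_measurable measurable_fst, map_sum,
        map_smul]
      simp only [Measure.mapₗ_apply_of_measurable measurable_fst]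
      refine Finset.sum_congr rfl fun a _ => ?_
      rw [← hπ1, Finset.sum_smul]
      refine Finset.sum_congr rfl fun b _ => ?_
      by_cases hab : π a b = 0
      · simp [hab]
      · have := cond_isProbabilityMeasure (hν a b hab)
        rw [Measure.map_fst_prod]; simp
    · conv_rhs => rw [← sum_meas_smul_cond_fiber hT ν]
      simp only [γ, Measure.snd, ← Measure.mapₗ_apply_of_measurable measurable_snd, map_sum,
        map_smul]
      simp only [Measure.mapₗ_apply_of_measurable measurable_snd]
      rw [Finset.sum_comm]
      refine Finset.sum_congr rfl fun b _ => ?_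
      rw [← hπ2, Finset.sum_smul]
      refine Finset.sum_congr rfl fun a _ => ?_
      by_cases hab : π a b = 0
      · simp [hab]
      · have := cond_isProbabilityMeasure (hμ a b hab)
        rw [Measure.map_snd_prod]; simp
  refine (iInf₂_le γ hγ).trans ?_
  simp only [γ, lintegral_finsetSum_measure, lintegral_smul_measure, smul_eq_mul]
  refine Finset.sum_le_sum fun a _ => Finset.sum_le_sum fun b _ => ?_
  by_cases hab : π a b = 0
  · simp [hab]
  have := cond_isProbabilityMeasure (hμ a b hab)
  have := cond_isProbabilityMeasure (hν a b hab)
  gcongr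
  have h1 : ∀ᵐ x ∂μ[|T ⁻¹' {a}], x ∈ S ∧ T x = a :=
    Filter.Eventually.and (cond_absolutelyContinuous.ae_le hμS) (ae_cond_mem (hm a))
  have h2 : ∀ᵐ x ∂ν[|T ⁻¹' {b}], x ∈ S ∧ T x = b :=
    Filter.Eventually.and (cond_absolutelyContinuous.ae_le hνS) (ae_cond_mem (hm b))
  calc ∫⁻ z, edist z.1 z.2 ∂(μ[|T ⁻¹' {a}]).prod (ν[|T ⁻¹' {b}])
      ≤ ∫⁻ _, D a b ∂(μ[|T ⁻¹' {a}]).prod (ν[|T ⁻¹' {b}]) := by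
        refine lintegral_mono_ae ?_
        have e1 := Measure.quasiMeasurePreserving_fst (μ := μ[|T ⁻¹' {a}]) (ν := ν[|T ⁻¹' {b}])
          |>.ae h1
        have e2 := Measure.quasiMeasurePreserving_snd (μ := μ[|T ⁻¹' {a}]) (ν := ν[|T ⁻¹' {b}])
          |>.ae h2
        filter_upwards [e1, e2] with z hz1 hz2
        have := hD _ hz1.1 _ hz2.1
        rwa [hz1.2, hz2.2] at this
    _ = D a b := by simp

/-! ### Dependence of the Wasserstein distance on the sample. -/

theorem isProbabilityMeasure_empiricalMeasure {E : Type*} [MeasurableSpace E] {n : ℕ} (hn : n ≠ 0)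
    (x : Fin n → E) : IsProbabilityMeasure (empiricalMeasure x) := by
  constructor
  simp [empiricalMeasure, ENNReal.inv_mul_cancel, hn]

theorem lintegral_empiricalMeasure {E : Type*} [MeasurableSpace E] [MeasurableSingletonClass E]
    {n : ℕ} (x : Fin n → E) (f : E → ℝ≥0∞) :
    ∫⁻ z, f z ∂empiricalMeasure x = (n : ℝ≥0∞)⁻¹ * ∑ i, f (x i) := by
  simp [empiricalMeasure, lintegral_finsetSum_measure, lintegral_smul_measure]

/-- The Wasserstein distance between an empirical measure and a fixed measure is `1`-Lipschitz in
the sample. -/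
theorem wasserstein1_empiricalMeasure_le_add_edist {E : Type*} [PseudoEMetricSpace E]
    [MeasurableSpace E] [OpensMeasurableSpace E] [SecondCountableTopology E] [StandardBorelSpace E]
    [Nonempty E] {n : ℕ} (hn : n ≠ 0) (μ : Measure E) (x y : Fin n → E) :
    wasserstein1 (empiricalMeasure y) μ ≤ wasserstein1 (empiricalMeasure x) μ + edist y x := by
  have hx := isProbabilityMeasure_empiricalMeasure hn x
  rw [wasserstein1, wasserstein1, ENNReal.iInf_add]
  refine le_iInf fun γ => ?_
  rw [ENNReal.iInf_add]
  refine le_iInf fun hγ => ?_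
  have hγf : IsProbabilityMeasure γ := by
    constructor
    have : γ.fst Set.univ = 1 := by rw [hγ.1]; exact measure_univ
    rwa [Measure.fst_univ] at this
  -- Any coupling is disintegrated over the atoms `x i`; moving each atom to `y i` while keeping its
  -- kernel gives a coupling for `y`, at an extra cost of at most the sup distance.
  let κ := γ.condKernel
  have hκ : empiricalMeasure x ⊗ₘ κ = γ := by rw [← hγ.1]; exact γ.disintegrate κ
  have hem : Measurable fun z : E × E => edist z.1 z.2 := measurable_edist
  let γ' : Measure (E × E) := (n : ℝ≥0∞)⁻¹ • ∑ i, (Measure.dirac (y i)).prod (κ (x i))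
  have hγ' : γ' ∈ couplings (empiricalMeasure y) μ := by
    constructor
    · simp only [γ', empiricalMeasure, Measure.fst,
        ← Measure.mapₗ_apply_of_measurable measurable_fst, map_sum, map_smul]
      simp only [Measure.mapₗ_apply_of_measurable measurable_fst, Measure.map_fst_prod]
      simp
    · rw [← hγ.2, ← hκ]
      ext s hs
      rw [Measure.snd_apply hs, Measure.snd_apply hs,
        Measure.compProd_apply (measurable_snd hs), lintegral_empiricalMeasure]
      simp [γ', Measure.dirac_prod, Measure.map_apply measurable_prodMk_left (measurable_snd hs)]
      rfl
  refine (iInf₂_le γ' hγ').trans ?_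
  rw [← hκ, Measure.lintegral_compProd hem, lintegral_empiricalMeasure]
  simp only [γ', lintegral_smul_measure, lintegral_finsetSum_measure, smul_eq_mul,
    Measure.dirac_prod, lintegral_map hem measurable_prodMk_left]
  calc (n : ℝ≥0∞)⁻¹ * ∑ i, ∫⁻ z, edist (y i) z ∂κ (x i)
      ≤ (n : ℝ≥0∞)⁻¹ * ∑ i, (∫⁻ z, edist (x i) z ∂κ (x i) + edist y x) := by
        gcongr with i
        calc ∫⁻ z, edist (y i) z ∂κ (x i) ≤ ∫⁻ z, (edist (x i) z + edist y x) ∂κ (x i) := by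
              refine lintegral_mono fun z => ?_
              rw [add_comm]
              exact (edist_triangle _ (x i) _).trans (by gcongr; exact edist_le_pi_edist y x i)
          _ = _ := by rw [lintegral_add_right _ measurable_const]; simp
    _ = _ := by
      rw [Finset.sum_add_distrib, mul_add]
      congr 1
      rw [Finset.sum_const, Finset.card_univ, Fintype.card_fin, nsmul_eq_mul, ← mul_assoc,
        ENNReal.inv_mul_cancel (by exact_mod_cast hn) (ENNReal.natCast_ne_top n), one_mul]

/-- Supplies measurability in `ω`, which is not apparent from an infimum over uncountably many
couplings. -/
theorem continuous_wasserstein1_empiricalMeasure {E : Type*} [PseudoEMetricSpace E]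
    [MeasurableSpace E] [OpensMeasurableSpace E] [SecondCountableTopology E] [StandardBorelSpace E]
    [Nonempty E] {n : ℕ} (hn : n ≠ 0) (μ : Measure E) :
    Continuous fun x : Fin n → E => wasserstein1 (empiricalMeasure x) μ :=
  continuous_of_le_add_edist 1 (by simp) fun x y => by
    simpa using wasserstein1_empiricalMeasure_le_add_edist hn μ y x

/-! ### Fourier analysis and the `H⁻¹` norm on the discrete torus. -/

section DiscreteTorus

open Finset

variable {M : ℕ} [NeZero M]

/-- The character of the discrete torus `(ℤ/M)²` of frequency `m`. -/
noncomputable def torusChar (m x : ZMod M × ZMod M) : ℂ :=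
  ZMod.stdAddChar (m.1 * x.1) * ZMod.stdAddChar (m.2 * x.2)

/-- The (unnormalized) Fourier transform on the discrete torus `(ℤ/M)²`. -/
noncomputable def torusFourier (f : ZMod M × ZMod M → ℂ) (m : ZMod M × ZMod M) : ℂ :=
  ∑ x, f x * torusChar m x

/-- The eigenvalue of the discrete Laplacian on `(ℤ/M)²` at frequency `m`. -/
noncomputable def torusEigenvalue (m : ZMod M × ZMod M) : ℝ :=
  ‖(ZMod.stdAddChar m.1 : ℂ) - 1‖ ^ 2 + ‖(ZMod.stdAddChar m.2 : ℂ) - 1‖ ^ 2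

theorem norm_torusChar (m x : ZMod M × ZMod M) : ‖torusChar m x‖ = 1 := by
  simp [torusChar, AddChar.norm_apply]

theorem sum_torusChar_mul_conj (x y : ZMod M × ZMod M) :
    ∑ m, torusChar m x * starRingEnd ℂ (torusChar m y) = if x = y then (M : ℂ) ^ 2 else 0 := by
  have h : ∀ m : ZMod M × ZMod M, torusChar m x * starRingEnd ℂ (torusChar m y)
      = ZMod.stdAddChar (m.1 * (x.1 - y.1)) * ZMod.stdAddChar (m.2 * (x.2 - y.2)) := by
    intro m
    simp only [torusChar, map_mul, ← AddChar.map_neg_eq_conj]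
    rw [mul_sub, mul_sub, sub_eq_add_neg, sub_eq_add_neg, AddChar.map_add_eq_mul,
      AddChar.map_add_eq_mul]
    ring
  simp_rw [h, Fintype.sum_prod_type, ← Finset.mul_sum, ← Finset.sum_mul,
    AddChar.sum_mulShift _ (ZMod.isPrimitive_stdAddChar M), sub_eq_zero, Prod.ext_iff, ZMod.card]
  by_cases h1 : x.1 = y.1 <;> by_cases h2 : x.2 = y.2 <;> simp [h1, h2, sq]

/-- Parseval's identity on the discrete torus. -/
theorem sum_torusFourier_mul_conj (f g : ZMod M × ZMod M → ℂ) :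
    ∑ m, torusFourier f m * starRingEnd ℂ (torusFourier g m)
      = (M : ℂ) ^ 2 * ∑ x, f x * starRingEnd ℂ (g x) := by
  have h : ∀ m, torusFourier f m * starRingEnd ℂ (torusFourier g m)
      = ∑ x, ∑ y, f x * starRingEnd ℂ (g y) *
          (torusChar m x * starRingEnd ℂ (torusChar m y)) := by
    intro m
    simp only [torusFourier, map_sum, map_mul, Finset.sum_mul_sum]
    exact sum_congr rfl fun x _ => sum_congr rfl fun y _ => by ring
  simp_rw [h]
  rw [sum_comm, mul_sum]
  refine sum_congr rfl fun x _ => ?_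
  rw [sum_comm]
  simp_rw [← mul_sum, sum_torusChar_mul_conj]
  simp [mul_comm]

theorem sum_norm_sq_torusFourier (f : ZMod M × ZMod M → ℂ) :
    ∑ m, ‖torusFourier f m‖ ^ 2 = (M : ℝ) ^ 2 * ∑ x, ‖f x‖ ^ 2 := by
  have h := sum_torusFourier_mul_conj f f
  simp_rw [Complex.mul_conj, Complex.normSq_eq_norm_sq] at h
  exact_mod_cast h

/-- Summation by parts: the backward shift of `f` becomes a forward shift of the character, so
differences act as multipliers. -/
theorem torusFourier_diff_fst (f : ZMod M × ZMod M → ℂ) (m : ZMod M × ZMod M) :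
    torusFourier (fun x => f (x - (1, 0)) - f x) m
      = (ZMod.stdAddChar m.1 - 1) * torusFourier f m := by
  have h : ∑ x, f (x - (1, 0)) * torusChar m x = ∑ x, f x * torusChar m (x + (1, 0)) :=
    Fintype.sum_equiv (Equiv.subRight (1, 0)) _ _ fun x => by simp
  simp only [torusFourier, sub_mul, sum_sub_distrib, h, mul_sum, one_mul]
  congr 1
  refine sum_congr rfl fun x _ => ?_
  simp only [torusChar, Prod.fst_add, Prod.snd_add, mul_add, AddChar.map_add_eq_mul, mul_one,
    mul_zero, AddChar.map_zero_eq_one]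
  ring

theorem torusFourier_diff_snd (f : ZMod M × ZMod M → ℂ) (m : ZMod M × ZMod M) :
    torusFourier (fun x => f (x - (0, 1)) - f x) m
      = (ZMod.stdAddChar m.2 - 1) * torusFourier f m := by
  have h : ∑ x, f (x - (0, 1)) * torusChar m x = ∑ x, f x * torusChar m (x + (0, 1)) :=
    Fintype.sum_equiv (Equiv.subRight (0, 1)) _ _ fun x => by simp
  simp only [torusFourier, sub_mul, sum_sub_distrib, h, mul_sum, one_mul]
  congr 1
  refine sum_congr rfl fun x _ => ?_
  simp only [torusChar, Prod.fst_add, Prod.snd_add, mul_add, AddChar.map_add_eq_mul, mul_one,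
    mul_zero, AddChar.map_zero_eq_one]
  ring

theorem sum_eigenvalue_mul_norm_sq_torusFourier (f : ZMod M × ZMod M → ℂ) :
    ∑ m, torusEigenvalue m * ‖torusFourier f m‖ ^ 2
      = (M : ℝ) ^ 2 * ∑ x, (‖f (x - (1, 0)) - f x‖ ^ 2 + ‖f (x - (0, 1)) - f x‖ ^ 2) := by
  rw [sum_add_distrib, mul_add, ← sum_norm_sq_torusFourier, ← sum_norm_sq_torusFourier,
    ← sum_add_distrib]
  refine sum_congr rfl fun m _ => ?_
  rw [torusFourier_diff_fst, torusFourier_diff_snd, norm_mul, norm_mul, torusEigenvalue]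
  ring

/-- With `k` the balanced representative, the norm is `2 |sin (π k / M)|`. As `|k| ≤ M / 2`,
Jordan's inequality `|sin t| ≥ 2 |t| / π` applies. -/
theorem le_norm_stdAddChar_sub_one (z : ZMod M) :
    4 * (z.valMinAbs.natAbs : ℝ) / M ≤ ‖(ZMod.stdAddChar z : ℂ) - 1‖ := by
  have hM : (0 : ℝ) < M := by exact_mod_cast NeZero.pos M
  have hk : (z.valMinAbs.natAbs : ℝ) = |(z.valMinAbs : ℝ)| := by
    rw [Nat.cast_natAbs, Int.cast_abs]
  have hle : |(z.valMinAbs : ℝ)| * 2 ≤ M := by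
    rw [← hk]
    have := ZMod.natAbs_valMinAbs_le z
    exact_mod_cast (by omega : z.valMinAbs.natAbs * 2 ≤ M)
  conv_rhs => rw [← ZMod.coe_valMinAbs z, ZMod.stdAddChar_coe]
  have e : 2 * (Real.pi : ℂ) * Complex.I * (z.valMinAbs : ℂ) / (M : ℂ)
      = Complex.I * ((2 * Real.pi * z.valMinAbs / M : ℝ) : ℂ) := by push_cast; ring
  rw [e, Complex.norm_exp_I_mul_ofReal_sub_one, hk, norm_mul, Real.norm_eq_abs, Real.norm_eq_abs]
  have habs : |2 * Real.pi * z.valMinAbs / M / 2| = Real.pi * |(z.valMinAbs : ℝ)| / M := by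
    rw [show 2 * Real.pi * z.valMinAbs / M / 2 = Real.pi * z.valMinAbs / M by ring, abs_div,
      abs_mul, abs_of_pos Real.pi_pos, abs_of_pos hM]
  have hb : |2 * Real.pi * z.valMinAbs / M / 2| ≤ Real.pi / 2 := by
    rw [habs, div_le_div_iff₀ hM two_pos]
    nlinarith [Real.pi_pos]
  have := Real.mul_abs_le_abs_sin hb
  rw [habs] at this
  calc 4 * |(z.valMinAbs : ℝ)| / M
      = |2| * (2 / Real.pi * (Real.pi * |(z.valMinAbs : ℝ)| / M)) := by
        rw [abs_two]; field_simp; ring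
    _ ≤ _ := by gcongr

theorem le_torusEigenvalue (m : ZMod M × ZMod M) :
    16 / (M : ℝ) ^ 2 * ((m.1.valMinAbs.natAbs : ℝ) ^ 2 + (m.2.valMinAbs.natAbs : ℝ) ^ 2)
      ≤ torusEigenvalue m := by
  have h1 := pow_le_pow_left₀ (by positivity) (le_norm_stdAddChar_sub_one m.1) 2
  have h2 := pow_le_pow_left₀ (by positivity) (le_norm_stdAddChar_sub_one m.2) 2
  calc _ = (4 * (m.1.valMinAbs.natAbs : ℝ) / M) ^ 2 + (4 * (m.2.valMinAbs.natAbs : ℝ) / M) ^ 2 := by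
        ring
    _ ≤ _ := add_le_add h1 h2

theorem torusEigenvalue_nonneg (m : ZMod M × ZMod M) : 0 ≤ torusEigenvalue m := by
  unfold torusEigenvalue; positivity

theorem torusEigenvalue_pos {m : ZMod M × ZMod M} (hm : m ≠ 0) : 0 < torusEigenvalue m := by
  refine lt_of_lt_of_le ?_ (le_torusEigenvalue m)
  have hM : (0 : ℝ) < M := by exact_mod_cast NeZero.pos M
  refine mul_pos (by positivity) ?_
  by_cases h1 : m.1 = 0
  · have h2 : m.2 ≠ 0 := fun h2 => hm (Prod.ext h1 h2)
    have : (0 : ℝ) < m.2.valMinAbs.natAbs := by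
      exact_mod_cast Int.natAbs_pos.mpr (by simpa using h2)
    positivity
  · have : (0 : ℝ) < m.1.valMinAbs.natAbs := by
      exact_mod_cast Int.natAbs_pos.mpr (by simpa using h1)
    positivity

/-- The `H¹`–`H⁻¹` duality inequality on the discrete torus. -/
theorem sq_sum_mul_le_of_diff_le (f a : ZMod M × ZMod M → ℝ) (ha : ∑ x, a x = 0) {L : ℝ}
    (h1 : ∀ x, |f (x - (1, 0)) - f x| ≤ L) (h2 : ∀ x, |f (x - (0, 1)) - f x| ≤ L) :
    (∑ x, f x * a x) ^ 2
      ≤ 2 * L ^ 2 * ∑ m, ‖torusFourier (fun x => (a x : ℂ)) m‖ ^ 2 / torusEigenvalue m := by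
  set F := torusFourier fun x => (f x : ℂ) with hF
  set A := torusFourier fun x => (a x : ℂ) with hA
  have hM : (0 : ℝ) < M := by exact_mod_cast NeZero.pos M
  -- Mean zero removes frequency `0`, where the eigenvalue vanishes and division by zero gives `0`.
  have hA0 : A 0 = 0 := by
    simp only [hA, torusFourier, torusChar, Prod.fst_zero, Prod.snd_zero, zero_mul,
      AddChar.map_zero_eq_one, mul_one]
    exact_mod_cast ha
  have hpars : (M : ℝ) ^ 2 * |∑ x, f x * a x| ≤ ∑ m, ‖F m‖ * ‖A m‖ := by
    have h := sum_torusFourier_mul_conj (fun x => (f x : ℂ)) (fun x => (a x : ℂ))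
    have h' : ((M : ℂ) ^ 2 * ∑ x, (f x : ℂ) * starRingEnd ℂ (a x : ℂ))
        = (((M : ℝ) ^ 2 * ∑ x, f x * a x : ℝ) : ℂ) := by
      simp
    rw [h'] at h
    have h3 := congrArg norm h
    rw [Complex.norm_real, Real.norm_eq_abs, abs_mul, abs_of_pos (by positivity)] at h3
    rw [← h3]
    refine (norm_sum_le _ _).trans (le_of_eq ?_)
    simp [hF, hA]
  have hterm : ∀ m, ‖F m‖ * ‖A m‖
      = (√(torusEigenvalue m) * ‖F m‖) * (‖A m‖ / √(torusEigenvalue m)) := by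
    intro m
    by_cases hm : m = 0
    · simp [hm, hA0]
    · have := Real.sqrt_pos.mpr (torusEigenvalue_pos hm)
      field_simp
  -- Cauchy–Schwarz with weights `√λ` and `1/√λ`: the first factor is the Dirichlet energy of `f`,
  -- the second the `H⁻¹` norm of `a`.
  have hcs := sum_mul_sq_le_sq_mul_sq univ (fun m => √(torusEigenvalue m) * ‖F m‖)
    (fun m => ‖A m‖ / √(torusEigenvalue m))
  simp_rw [← hterm, mul_pow, div_pow, Real.sq_sqrt (torusEigenvalue_nonneg _)] at hcs
  have hgrad : ∑ m, torusEigenvalue m * ‖F m‖ ^ 2 ≤ (M : ℝ) ^ 4 * (2 * L ^ 2) := by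
    rw [hF, sum_eigenvalue_mul_norm_sq_torusFourier]
    have : ∀ x : ZMod M × ZMod M, ‖(f (x - (1, 0)) : ℂ) - f x‖ ^ 2
        + ‖(f (x - (0, 1)) : ℂ) - f x‖ ^ 2 ≤ 2 * L ^ 2 := by
      intro x
      rw [← Complex.ofReal_sub, ← Complex.ofReal_sub, Complex.norm_real, Complex.norm_real,
        Real.norm_eq_abs, Real.norm_eq_abs, two_mul]
      exact add_le_add (pow_le_pow_left₀ (abs_nonneg _) (h1 x) 2)
        (pow_le_pow_left₀ (abs_nonneg _) (h2 x) 2)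
    calc _ ≤ (M : ℝ) ^ 2 * ∑ _x : ZMod M × ZMod M, 2 * L ^ 2 := by
          gcongr with x; exact this x
      _ = _ := by
        simp [ZMod.card]; ring
  have hS : 0 ≤ ∑ m, ‖A m‖ ^ 2 / torusEigenvalue m :=
    sum_nonneg fun m _ => div_nonneg (by positivity) (torusEigenvalue_nonneg m)
  have h4 : (M : ℝ) ^ 4 * (∑ x, f x * a x) ^ 2
      ≤ (M : ℝ) ^ 4 * (2 * L ^ 2 * ∑ m, ‖A m‖ ^ 2 / torusEigenvalue m) := by
    calc (M : ℝ) ^ 4 * (∑ x, f x * a x) ^ 2 = ((M : ℝ) ^ 2 * |∑ x, f x * a x|) ^ 2 := by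
          rw [mul_pow, sq_abs]; ring
      _ ≤ (∑ m, ‖F m‖ * ‖A m‖) ^ 2 := pow_le_pow_left₀ (by positivity) hpars 2
      _ ≤ _ := hcs
      _ ≤ (M : ℝ) ^ 4 * (2 * L ^ 2) * ∑ m, ‖A m‖ ^ 2 / torusEigenvalue m := by gcongr
      _ = _ := by ring
  exact le_of_mul_le_mul_left h4 (by positivity)

/-! ### The lattice sum producing the logarithm. -/

/-- At most two residues, `k` and `-k`, share the absolute value `k`. -/
theorem sum_natAbs_valMinAbs_le (F : ℕ → ℝ) (hF : ∀ k, 0 ≤ F k) :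
    ∑ z : ZMod M, F z.valMinAbs.natAbs ≤ 2 * ∑ k ∈ range (M / 2 + 1), F k := by
  rw [← sum_fiberwise_of_maps_to (s := univ) (t := range (M / 2 + 1))
    (g := fun z : ZMod M => z.valMinAbs.natAbs)
    (fun z _ => mem_range.mpr (Nat.lt_succ_of_le (ZMod.natAbs_valMinAbs_le z))), mul_sum]
  refine sum_le_sum fun k _ => ?_
  rw [sum_congr rfl (g := fun _ => F k) fun z hz => by rw [(mem_filter.mp hz).2], sum_const,
    nsmul_eq_mul]
  refine mul_le_mul_of_nonneg_right ?_ (hF k)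
  have hsub : (univ.filter fun z : ZMod M => z.valMinAbs.natAbs = k)
      ⊆ {(k : ZMod M), -(k : ZMod M)} := by
    intro z hz
    have hz := (mem_filter.mp hz).2
    rw [mem_insert, mem_singleton]
    rcases Int.natAbs_eq z.valMinAbs with h | h
    · left; rw [← ZMod.coe_valMinAbs z, h, hz]; simp
    · right; rw [← ZMod.coe_valMinAbs z, h, hz]; simp
  exact_mod_cast (card_le_card hsub).trans card_le_two

/-- A row sums to `O(1/i)`, so summing over rows leaves a harmonic series. -/
theorem sum_range_inv_sq_add_sq_le {i : ℕ} (hi : i ≠ 0) (K : ℕ) :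
    ∑ j ∈ range (K + 1), ((i : ℝ) ^ 2 + (j : ℝ) ^ 2)⁻¹ ≤ 3 * (i : ℝ)⁻¹ := by
  have hi1 : (1 : ℝ) ≤ i := by exact_mod_cast Nat.one_le_iff_ne_zero.mpr hi
  -- The sharpened bound telescopes because `(i + K)(i + K + 1) ≤ 2 (i² + (K + 1)²)`.
  have key : ∀ K : ℕ, ∑ j ∈ range (K + 1), ((i : ℝ) ^ 2 + (j : ℝ) ^ 2)⁻¹
      ≤ 3 * (i : ℝ)⁻¹ - 2 * ((i : ℝ) + K)⁻¹ := by
    intro K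
    induction K with
    | zero =>
      simp only [zero_add, range_one, sum_singleton, Nat.cast_zero, add_zero]
      have : ((i : ℝ) ^ 2 + 0 ^ 2)⁻¹ ≤ (i : ℝ)⁻¹ := by
        apply inv_anti₀ (by positivity); nlinarith
      linarith
    | succ K ih =>
      rw [sum_range_succ]
      have : ((i : ℝ) ^ 2 + ((K + 1 : ℕ) : ℝ) ^ 2)⁻¹
          ≤ 2 * ((i : ℝ) + K)⁻¹ - 2 * ((i : ℝ) + (K + 1 : ℕ))⁻¹ := by
        push_cast
        have hK : (0 : ℝ) ≤ K := by positivity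
        rw [← mul_sub, inv_sub_inv (by positivity) (by positivity), inv_eq_one_div, ← mul_div_assoc,
          div_le_div_iff₀ (by positivity) (by positivity)]
        nlinarith [sq_nonneg ((i : ℝ) - (K + 1))]
      linarith
  have := key K
  have h0 : (0 : ℝ) ≤ 2 * ((i : ℝ) + K)⁻¹ := by positivity
  linarith

theorem sum_range_inv_sq_le (K : ℕ) : ∑ j ∈ range (K + 1), ((j : ℝ) ^ 2)⁻¹ ≤ 2 := by
  have key : ∀ K : ℕ, ∑ j ∈ range (K + 2), ((j : ℝ) ^ 2)⁻¹ ≤ 2 - ((K : ℝ) + 1)⁻¹ := by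
    intro K
    induction K with
    | zero => norm_num [sum_range_succ]
    | succ K ih =>
      rw [sum_range_succ]
      have : (((K + 2 : ℕ) : ℝ) ^ 2)⁻¹ ≤ ((K : ℝ) + 1)⁻¹ - (((K + 1 : ℕ) : ℝ) + 1)⁻¹ := by
        push_cast
        rw [inv_sub_inv (by positivity) (by positivity), inv_eq_one_div,
          div_le_div_iff₀ (by positivity) (by positivity)]
        have hK : (0 : ℝ) ≤ K := by positivity
        nlinarith
      linarith
  have h0 : (0 : ℝ) ≤ ((K : ℝ) + 1)⁻¹ := by positivity
  refine (sum_le_sum_of_subset_of_nonneg (range_subset_range.mpr (Nat.le_succ (K + 1)))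
    fun _ _ _ => by positivity).trans ((key K).trans (by linarith))

theorem sum_sum_inv_sq_add_sq_le (K : ℕ) :
    ∑ i ∈ range (K + 1), ∑ j ∈ range (K + 1), ((i : ℝ) ^ 2 + (j : ℝ) ^ 2)⁻¹
      ≤ 5 + 3 * Real.log K := by
  rw [sum_range_succ']
  -- The row `i = 0` is separate; its term at the origin is `0⁻¹ = 0`.
  have h0 : ∑ j ∈ range (K + 1), (((0 : ℕ) : ℝ) ^ 2 + (j : ℝ) ^ 2)⁻¹ ≤ 2 := by
    simpa using sum_range_inv_sq_le K
  have h1 : ∑ i ∈ range K, ∑ j ∈ range (K + 1), (((i + 1 : ℕ) : ℝ) ^ 2 + (j : ℝ) ^ 2)⁻¹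
      ≤ 3 * (1 + Real.log K) := by
    calc _ ≤ ∑ i ∈ range K, 3 * (((i + 1 : ℕ) : ℝ))⁻¹ :=
          sum_le_sum fun i _ => sum_range_inv_sq_add_sq_le i.succ_ne_zero K
      _ = 3 * ((harmonic K : ℚ) : ℝ) := by
        rw [← mul_sum, harmonic]; push_cast; rfl
      _ ≤ _ := by gcongr; exact harmonic_le_one_add_log K
  linarith

/-- The trace of the inverse Laplacian on the discrete torus grows like `M² log M`. -/
theorem sum_inv_torusEigenvalue_le :
    ∑ m : ZMod M × ZMod M, (torusEigenvalue m)⁻¹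
      ≤ (M : ℝ) ^ 2 / 4 * (5 + 3 * Real.log (M / 2 : ℕ)) := by
  have hM : (0 : ℝ) < M := by exact_mod_cast NeZero.pos M
  have h1 : ∀ m : ZMod M × ZMod M, (torusEigenvalue m)⁻¹ ≤ (M : ℝ) ^ 2 / 16 *
      ((m.1.valMinAbs.natAbs : ℝ) ^ 2 + (m.2.valMinAbs.natAbs : ℝ) ^ 2)⁻¹ := by
    intro m
    by_cases hm : m = 0
    · simp [hm, torusEigenvalue]
    · have hpos : 0 < (m.1.valMinAbs.natAbs : ℝ) ^ 2 + (m.2.valMinAbs.natAbs : ℝ) ^ 2 := by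
        by_contra! h
        have e1 : (m.1.valMinAbs.natAbs : ℝ) = 0 := by
          nlinarith [sq_nonneg (m.1.valMinAbs.natAbs : ℝ), sq_nonneg (m.2.valMinAbs.natAbs : ℝ)]
        have e2 : (m.2.valMinAbs.natAbs : ℝ) = 0 := by
          nlinarith [sq_nonneg (m.1.valMinAbs.natAbs : ℝ), sq_nonneg (m.2.valMinAbs.natAbs : ℝ)]
        refine hm (Prod.ext ?_ ?_)
        · simpa using e1
        · simpa using e2
      have := inv_anti₀ (by positivity) (le_torusEigenvalue m)
      rwa [mul_inv, inv_div] at this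
  calc _ ≤ ∑ m : ZMod M × ZMod M, (M : ℝ) ^ 2 / 16 *
      ((m.1.valMinAbs.natAbs : ℝ) ^ 2 + (m.2.valMinAbs.natAbs : ℝ) ^ 2)⁻¹ :=
        sum_le_sum fun m _ => h1 m
    _ = (M : ℝ) ^ 2 / 16 * ∑ z : ZMod M, ∑ w : ZMod M,
      ((z.valMinAbs.natAbs : ℝ) ^ 2 + (w.valMinAbs.natAbs : ℝ) ^ 2)⁻¹ := by
        rw [← mul_sum, Fintype.sum_prod_type]
    _ ≤ (M : ℝ) ^ 2 / 16 * ∑ z : ZMod M, (2 * ∑ j ∈ range (M / 2 + 1),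
      ((z.valMinAbs.natAbs : ℝ) ^ 2 + (j : ℝ) ^ 2)⁻¹) := by
        gcongr with z
        exact sum_natAbs_valMinAbs_le
          (fun j => ((z.valMinAbs.natAbs : ℝ) ^ 2 + (j : ℝ) ^ 2)⁻¹) fun _ => by positivity
    _ ≤ (M : ℝ) ^ 2 / 16 * (2 * ∑ i ∈ range (M / 2 + 1), (2 * ∑ j ∈ range (M / 2 + 1),
      ((i : ℝ) ^ 2 + (j : ℝ) ^ 2)⁻¹)) := by
        gcongr
        exact sum_natAbs_valMinAbs_le
          (fun i => 2 * ∑ j ∈ range (M / 2 + 1), ((i : ℝ) ^ 2 + (j : ℝ) ^ 2)⁻¹)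
          fun _ => by positivity
    _ = (M : ℝ) ^ 2 / 4 * ∑ i ∈ range (M / 2 + 1), ∑ j ∈ range (M / 2 + 1),
      ((i : ℝ) ^ 2 + (j : ℝ) ^ 2)⁻¹ := by rw [← mul_sum]; ring
    _ ≤ _ := by gcongr; exact sum_sum_inv_sq_add_sq_le _

end DiscreteTorus

/-! ### Discretization of the square. -/

/-- The index in `{0, …, N - 1}` of the cell of side `1 / N` that contains `t ∈ [0, 1]`. -/
noncomputable def cellIndex (N : ℕ) (t : ℝ) : ℕ := min ⌊N * t⌋₊ (N - 1)

/-- The cell of a point of the plane, as a point of the discrete torus of side `2 N`. -/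
noncomputable def torusCell (N : ℕ) (x : Plane) : ZMod (2 * N) × ZMod (2 * N) :=
  (cellIndex N (x 0), cellIndex N (x 1))

/-- The `ℓ¹` distance on the discrete torus of side `2 N`, with mesh `1 / N`. -/
noncomputable def torusDist (N : ℕ) (a b : ZMod (2 * N) × ZMod (2 * N)) : ℝ :=
  (((a.1 - b.1).valMinAbs.natAbs : ℝ) + ((a.2 - b.2).valMinAbs.natAbs : ℝ)) / N

theorem measurable_cellIndex (N : ℕ) : Measurable (cellIndex N) := by
  unfold cellIndex
  exact (Nat.measurable_floor.comp (measurable_const_mul _)).min measurable_const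

theorem measurable_torusCell (N : ℕ) : Measurable (torusCell N) := by
  unfold torusCell
  have h : ∀ i : Fin 2, Measurable fun x : Plane => ((cellIndex N (x i) : ℕ) : ZMod (2 * N)) :=
    fun i => (measurable_of_countable (fun k : ℕ => (k : ZMod (2 * N)))).comp
      ((measurable_cellIndex N).comp (by fun_prop))
  exact (h 0).prodMk (h 1)

theorem cellIndex_lt {N : ℕ} (hN : N ≠ 0) (t : ℝ) : cellIndex N t < N := by
  unfold cellIndex; omega

theorem cellIndex_le {N : ℕ} {t : ℝ} (ht : t ∈ Set.Icc (0 : ℝ) 1) : (cellIndex N t : ℝ) ≤ N * t :=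
  (Nat.cast_le.mpr (min_le_left _ _)).trans
    (Nat.floor_le (mul_nonneg (Nat.cast_nonneg N) ht.1))

theorem le_cellIndex_add_one {N : ℕ} (hN : N ≠ 0) {t : ℝ} (ht : t ∈ Set.Icc (0 : ℝ) 1) :
    N * t ≤ cellIndex N t + 1 := by
  unfold cellIndex
  rcases min_choice ⌊N * t⌋₊ (N - 1) with h | h <;> rw [h]
  · exact (Nat.lt_floor_add_one _).le
  · rw [Nat.cast_sub (Nat.one_le_iff_ne_zero.mpr hN), Nat.cast_one, sub_add_cancel]
    exact mul_le_of_le_one_right (Nat.cast_nonneg N) ht.2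

/-- This is why the torus has side `2 N`: index differences lie strictly between `-N` and `N`, so
none wraps around. -/
theorem valMinAbs_natCast_sub_natCast {N i j : ℕ} (hi : i < N) (hj : j < N) :
    ((i : ZMod (2 * N)) - j).valMinAbs = (i : ℤ) - j := by
  have : NeZero (2 * N) := ⟨by omega⟩
  rw [ZMod.valMinAbs_spec]
  refine ⟨by push_cast; rfl, ?_⟩
  constructor <;> push_cast <;> omega

theorem abs_sub_le_cellIndex {N : ℕ} (hN : N ≠ 0) {s t : ℝ} (hs : s ∈ Set.Icc (0 : ℝ) 1)
    (ht : t ∈ Set.Icc (0 : ℝ) 1) :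
    |s - t| ≤ ((((cellIndex N s : ZMod (2 * N)) - cellIndex N t).valMinAbs.natAbs : ℝ) + 1) / N := by
  have hN0 : (0 : ℝ) < N := by exact_mod_cast Nat.pos_of_ne_zero hN
  rw [valMinAbs_natCast_sub_natCast (cellIndex_lt hN s) (cellIndex_lt hN t), le_div_iff₀ hN0,
    Nat.cast_natAbs, Int.cast_abs]
  push_cast
  have h1 := cellIndex_le (N := N) hs
  have h2 := cellIndex_le (N := N) ht
  have h3 := le_cellIndex_add_one hN hs
  have h4 := le_cellIndex_add_one hN ht
  have h5 := le_abs_self ((cellIndex N s : ℝ) - cellIndex N t)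
  have h6 := neg_abs_le ((cellIndex N s : ℝ) - cellIndex N t)
  have h7 : |s - t| * N = |(s - t) * N| := by rw [abs_mul, abs_of_pos hN0]
  rw [h7, abs_le]
  constructor <;> linarith

/-- The Euclidean distance is at most the `ℓ¹` distance, and rounding to cells costs `1 / N` per
coordinate. -/
theorem edist_le_torusDist {N : ℕ} (hN : N ≠ 0) {x y : Plane} (hx : x ∈ unitSquare)
    (hy : y ∈ unitSquare) :
    edist x y ≤ ENNReal.ofReal (torusDist N (torusCell N x) (torusCell N y) + 2 / N) := by
  rw [edist_dist]
  refine ENNReal.ofReal_le_ofReal ?_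
  have h0 := abs_sub_le_cellIndex hN (hx 0) (hy 0)
  have h1 := abs_sub_le_cellIndex hN (hx 1) (hy 1)
  have hd : dist x y ≤ |x 0 - y 0| + |x 1 - y 1| := by
    rw [EuclideanSpace.dist_eq, Fin.sum_univ_two, Real.dist_eq, Real.dist_eq]
    refine Real.sqrt_le_iff.mpr ⟨by positivity, ?_⟩
    nlinarith [mul_nonneg (abs_nonneg (x 0 - y 0)) (abs_nonneg (x 1 - y 1))]
  refine (hd.trans (add_le_add h0 h1)).trans (le_of_eq ?_)
  simp only [torusDist, torusCell]
  ring

theorem torusDist_self (N : ℕ) (a : ZMod (2 * N) × ZMod (2 * N)) : torusDist N a a = 0 := by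
  simp [torusDist]

theorem torusDist_nonneg (N : ℕ) (a b : ZMod (2 * N) × ZMod (2 * N)) : 0 ≤ torusDist N a b := by
  unfold torusDist; positivity

theorem natAbs_valMinAbs_sub_le {M : ℕ} (a b c : ZMod M) :
    (a - c).valMinAbs.natAbs ≤ (a - b).valMinAbs.natAbs + (b - c).valMinAbs.natAbs := by
  rw [← sub_add_sub_cancel a b c]
  exact (ZMod.natAbs_valMinAbs_add_le _ _).trans (Int.natAbs_add_le _ _)

theorem torusDist_triangle (N : ℕ) (a b c : ZMod (2 * N) × ZMod (2 * N)) :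
    torusDist N a c ≤ torusDist N a b + torusDist N b c := by
  unfold torusDist
  rw [← add_div]
  refine div_le_div_of_nonneg_right ?_ (Nat.cast_nonneg N)
  have h1 := natAbs_valMinAbs_sub_le a.1 b.1 c.1
  have h2 := natAbs_valMinAbs_sub_le a.2 b.2 c.2
  exact_mod_cast (by omega)

theorem natAbs_valMinAbs_one_le {N : ℕ} (hN : N ≠ 0) :
    (1 : ZMod (2 * N)).valMinAbs.natAbs ≤ 1 := by
  have : NeZero (2 * N) := ⟨by omega⟩
  have h : (1 : ZMod (2 * N)).valMinAbs = 1 := by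
    rw [ZMod.valMinAbs_spec]
    refine ⟨by simp, ?_⟩
    constructor <;> push_cast <;> omega
  rw [h]; rfl

/-- The squared discrete `H⁻¹` norm of the difference of the cell laws of `ν` and `μ`, which controls
transport on the torus. -/
noncomputable def cellEnergy (N : ℕ) [NeZero (2 * N)] (ν μ : Measure Plane) : ℝ :=
  ∑ m, ‖torusFourier (fun a =>
    ((ν.real (torusCell N ⁻¹' {a}) - μ.real (torusCell N ⁻¹' {a}) : ℝ) : ℂ)) m‖ ^ 2 / torusEigenvalue m

theorem sum_measureReal_fiber {E A : Type*} [MeasurableSpace E] [Fintype A] [MeasurableSpace A]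
    [DiscreteMeasurableSpace A] (μ : Measure E) [IsProbabilityMeasure μ] {T : E → A}
    (hT : Measurable T) (g : A → ℝ) : ∑ a, μ.real (T ⁻¹' {a}) * g a = ∫ x, g (T x) ∂μ := by
  rw [← integral_map (f := g) hT.aemeasurable (measurable_of_countable g).aestronglyMeasurable]
  have := Measure.isProbabilityMeasure_map (μ := μ) hT.aemeasurable
  rw [integral_fintype (Integrable.of_finite)]
  refine Finset.sum_congr rfl fun a _ => ?_
  rw [map_measureReal_apply hT (measurableSet_singleton a), smul_eq_mul]

theorem wasserstein1_le_sqrt_cellEnergy {N : ℕ} (hN : N ≠ 0) [NeZero (2 * N)]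
    (ν μ : Measure Plane) [IsProbabilityMeasure ν] [IsProbabilityMeasure μ]
    (hν : ∀ᵐ x ∂ν, x ∈ unitSquare) (hμ : ∀ᵐ x ∂μ, x ∈ unitSquare) :
    wasserstein1 ν μ
      ≤ ENNReal.ofReal (√(2 * (1 / (N : ℝ)) ^ 2 * cellEnergy N ν μ) + 2 / N) := by
  have hN0 : (0 : ℝ) < N := by exact_mod_cast Nat.pos_of_ne_zero hN
  have hT := measurable_torusCell N
  set p : ZMod (2 * N) × ZMod (2 * N) → ℝ := fun a => ν.real (torusCell N ⁻¹' {a}) with hp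
  set q : ZMod (2 * N) × ZMod (2 * N) → ℝ := fun a => μ.real (torusCell N ⁻¹' {a}) with hq
  have hp1 : ∑ a, p a = 1 := by simpa using sum_measureReal_fiber ν hT (fun _ => 1)
  have hq1 : ∑ a, q a = 1 := by simpa using sum_measureReal_fiber μ hT (fun _ => 1)
  -- A function Lipschitz for `torusDist` changes by at most `1 / N` between neighbours, so the
  -- `H¹`–`H⁻¹` inequality applies with `L = 1 / N`.
  have hlip : ∀ f : ZMod (2 * N) × ZMod (2 * N) → ℝ, (∀ a b, f a - f b ≤ torusDist N a b) →
      ∑ a, f a * (p a - q a) ≤ √(2 * (1 / (N : ℝ)) ^ 2 * cellEnergy N ν μ) := by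
    intro f hf
    refine Real.le_sqrt_of_sq_le ?_
    have h1' := natAbs_valMinAbs_one_le hN
    have h1 : ((1 : ZMod (2 * N)).valMinAbs.natAbs : ℝ) ≤ 1 := by exact_mod_cast h1'
    refine sq_sum_mul_le_of_diff_le f (fun a => p a - q a) (by simp [hp1, hq1]) ?_ ?_
    · intro x
      rw [abs_le]
      have e1 := hf (x - (1, 0)) x
      have e2 := hf x (x - (1, 0))
      simp only [torusDist, Prod.fst_sub, Prod.snd_sub, sub_sub_cancel, sub_sub_cancel_left,
        ZMod.natAbs_valMinAbs_neg, ZMod.valMinAbs_zero, Int.natAbs_zero, Nat.cast_zero,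
        add_zero] at e1 e2
      have : ((1 : ZMod (2 * N)).valMinAbs.natAbs : ℝ) / N ≤ 1 / N := by gcongr
      constructor <;> linarith
    · intro x
      rw [abs_le]
      have e1 := hf (x - (0, 1)) x
      have e2 := hf x (x - (0, 1))
      simp only [torusDist, Prod.fst_sub, Prod.snd_sub, sub_sub_cancel, sub_sub_cancel_left,
        ZMod.natAbs_valMinAbs_neg, ZMod.valMinAbs_zero, Int.natAbs_zero, Nat.cast_zero,
        zero_add, neg_zero] at e1 e2
      have : ((1 : ZMod (2 * N)).valMinAbs.natAbs : ℝ) / N ≤ 1 / N := by gcongr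
      constructor <;> linarith
  obtain ⟨π, hπ0, hπ1, hπ2, hπc⟩ := exists_coupling_of_lipschitz_sum_le (torusDist N)
    (torusDist_self N) (torusDist_triangle N) p q (fun _ => measureReal_nonneg)
    (fun _ => measureReal_nonneg) hp1 hq1 _ hlip
  have hW := wasserstein1_le_of_discrete_coupling ν μ hT hν hμ
    (fun a b => ENNReal.ofReal (torusDist N a b + 2 / N))
    (fun x hx y hy => edist_le_torusDist hN hx hy)
    (fun a b => ENNReal.ofReal (π (a, b)))
    (fun a => by
      rw [← ENNReal.ofReal_sum_of_nonneg fun b _ => hπ0 _, hπ1, hp]; simp)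
    (fun b => by
      rw [← ENNReal.ofReal_sum_of_nonneg fun a _ => hπ0 _, hπ2, hq]; simp)
  refine hW.trans ?_
  have hnn : ∀ a b, 0 ≤ π (a, b) * (torusDist N a b + 2 / N) := fun a b =>
    mul_nonneg (hπ0 _) (add_nonneg (torusDist_nonneg N a b) (by positivity))
  simp_rw [← ENNReal.ofReal_mul (hπ0 _)]
  rw [Finset.sum_congr rfl fun a _ => (ENNReal.ofReal_sum_of_nonneg fun b _ => hnn a b).symm,
    ← ENNReal.ofReal_sum_of_nonneg fun a _ => Finset.sum_nonneg fun b _ => hnn a b]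
  refine ENNReal.ofReal_le_ofReal ?_
  rw [Fintype.sum_prod_type] at hπc
  simp_rw [mul_add, Finset.sum_add_distrib, ← Finset.sum_mul, hπ1, hp1, one_mul]
  linarith

/-! ### Mean square fluctuations of empirical averages. -/

section Empirical

variable {E Ω : Type*} [MeasurableSpace E] [MeasurableSpace Ω] {μ : Measure E}
  {P : Measure Ω} [IsProbabilityMeasure P] {n : ℕ} {X : Fin n → Ω → E}

theorem integral_empiricalMeasure [MeasurableSingletonClass E] (x : Fin n → E) (f : E → ℝ) :
    ∫ z, f z ∂empiricalMeasure x = (n : ℝ)⁻¹ * ∑ i, f (x i) := by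
  rw [empiricalMeasure, integral_smul_measure, integral_finsetSum_measure]
  · simp
  · exact fun i _ => integrable_dirac (by simp)

/-- The mean square error of an empirical average. -/
theorem integrable_and_integral_sq_empirical_le (hn : n ≠ 0) (hX : ∀ i, HasLaw (X i) μ P)
    (hind : iIndepFun X P) {φ : E → ℝ} (hφ : Measurable φ) (hb : ∀ z, |φ z| ≤ 1) :
    Integrable (fun ω => ((n : ℝ)⁻¹ * ∑ i, φ (X i ω) - ∫ z, φ z ∂μ) ^ 2) P ∧
    ∫ ω, ((n : ℝ)⁻¹ * ∑ i, φ (X i ω) - ∫ z, φ z ∂μ) ^ 2 ∂P ≤ (n : ℝ)⁻¹ * ∫ z, φ z ^ 2 ∂μ := by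
  have hn0 : (n : ℝ) ≠ 0 := by exact_mod_cast hn
  have hae : ∀ i, AEMeasurable (fun ω => φ (X i ω)) P := fun i =>
    hφ.comp_aemeasurable (hX i).aemeasurable
  have hLp : ∀ i, MemLp (fun ω => φ (X i ω)) 2 P := fun i =>
    MemLp.of_bound (hae i).aestronglyMeasurable 1 (Filter.Eventually.of_forall fun ω => hb _)
  have hmean : ∀ i, ∫ ω, φ (X i ω) ∂P = ∫ z, φ z ∂μ := fun i => by
    rw [← (hX i).map_eq, integral_map (hX i).aemeasurable hφ.aestronglyMeasurable]
  have hmean2 : ∀ i, ∫ ω, φ (X i ω) ^ 2 ∂P = ∫ z, φ z ^ 2 ∂μ := fun i => by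
    rw [← (hX i).map_eq, integral_map (hX i).aemeasurable (hφ.pow_const 2).aestronglyMeasurable]
  have hsum : MemLp (∑ i, fun ω => φ (X i ω)) 2 P := memLp_finsetSum' _ fun i _ => hLp i
  have hY : MemLp (fun ω => (n : ℝ)⁻¹ * ∑ i, φ (X i ω)) 2 P := by
    have := hsum.const_mul (n : ℝ)⁻¹
    simpa [Finset.sum_apply] using this
  have hYmean : ∫ ω, (n : ℝ)⁻¹ * ∑ i, φ (X i ω) ∂P = ∫ z, φ z ∂μ := by
    rw [integral_const_mul, integral_finsetSum _ fun i _ => (hLp i).integrable (by norm_num)]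
    simp [hmean, hn0]
  refine ⟨(hY.sub (memLp_const _)).integrable_sq, ?_⟩
  have hvar := variance_eq_integral hY.aemeasurable
  rw [hYmean] at hvar
  rw [← hvar, variance_const_mul]
  have hs : Var[fun ω => ∑ i, φ (X i ω); P] = ∑ i, Var[fun ω => φ (X i ω); P] := by
    rw [← IndepFun.variance_sum (fun i _ => hLp i)]
    · congr 1; ext ω; simp
    · intro i _ j _ hij
      exact (hind.comp (fun _ => φ) fun _ => hφ).indepFun hij
  rw [hs]
  -- Each variance is bounded by the second moment, so that for a character the real and imaginary
  -- parts add up to `|χ|² = 1`.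
  calc ((n : ℝ)⁻¹) ^ 2 * ∑ i, Var[fun ω => φ (X i ω); P]
      ≤ ((n : ℝ)⁻¹) ^ 2 * ∑ _i : Fin n, ∫ z, φ z ^ 2 ∂μ := by
        gcongr with i
        rw [← hmean2 i]
        exact variance_le_expectation_sq (hae i).aestronglyMeasurable
    _ = _ := by
      rw [Finset.sum_const, Finset.card_univ, Fintype.card_fin, nsmul_eq_mul]
      field_simp

end Empirical

/-! ### Expected energy and expected transport cost. -/

section Energy

variable {Ω : Type*} [MeasurableSpace Ω] {μ : Measure Plane}
  [IsProbabilityMeasure μ] {P : Measure Ω} [IsProbabilityMeasure P] {n : ℕ} {X : Fin n → Ω → Plane}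

/-- The Fourier coefficient is the fluctuation of the empirical mean of one character, split into
real and imaginary parts. -/
theorem norm_sq_torusFourier_cell {N : ℕ} [NeZero (2 * N)] (hn : n ≠ 0) (x : Fin n → Plane)
    (m : ZMod (2 * N) × ZMod (2 * N)) :
    ‖torusFourier (fun a => (((empiricalMeasure x).real (torusCell N ⁻¹' {a})
        - μ.real (torusCell N ⁻¹' {a}) : ℝ) : ℂ)) m‖ ^ 2
      = ((n : ℝ)⁻¹ * ∑ i, (torusChar m (torusCell N (x i))).re
          - ∫ z, (torusChar m (torusCell N z)).re ∂μ) ^ 2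
        + ((n : ℝ)⁻¹ * ∑ i, (torusChar m (torusCell N (x i))).im
          - ∫ z, (torusChar m (torusCell N z)).im ∂μ) ^ 2 := by
  have := isProbabilityMeasure_empiricalMeasure hn x
  have hT := measurable_torusCell N
  rw [← Complex.normSq_eq_norm_sq, Complex.normSq_apply, ← sq, ← sq]
  congr 2
  · rw [← integral_empiricalMeasure x fun z => (torusChar m (torusCell N z)).re,
      ← sum_measureReal_fiber _ hT fun a => (torusChar m a).re,
      ← sum_measureReal_fiber _ hT fun a => (torusChar m a).re, ← Finset.sum_sub_distrib,
      torusFourier, Complex.re_sum]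
    exact Finset.sum_congr rfl fun a _ => by rw [Complex.re_ofReal_mul, sub_mul]
  · rw [← integral_empiricalMeasure x fun z => (torusChar m (torusCell N z)).im,
      ← sum_measureReal_fiber _ hT fun a => (torusChar m a).im,
      ← sum_measureReal_fiber _ hT fun a => (torusChar m a).im, ← Finset.sum_sub_distrib,
      torusFourier, Complex.im_sum]
    exact Finset.sum_congr rfl fun a _ => by rw [Complex.im_ofReal_mul, sub_mul]

theorem integrable_and_integral_norm_sq_torusFourier_le {N : ℕ} [NeZero (2 * N)] (hn : n ≠ 0)
    (hX : ∀ i, HasLaw (X i) μ P) (hind : iIndepFun X P) (m : ZMod (2 * N) × ZMod (2 * N)) :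
    Integrable (fun ω => ‖torusFourier (fun a => (((empiricalMeasure fun i => X i ω).real
      (torusCell N ⁻¹' {a}) - μ.real (torusCell N ⁻¹' {a}) : ℝ) : ℂ)) m‖ ^ 2) P ∧
    ∫ ω, ‖torusFourier (fun a => (((empiricalMeasure fun i => X i ω).real
      (torusCell N ⁻¹' {a}) - μ.real (torusCell N ⁻¹' {a}) : ℝ) : ℂ)) m‖ ^ 2 ∂P ≤ (n : ℝ)⁻¹ := by
  have hT := measurable_torusCell N
  have hm : ∀ g : ZMod (2 * N) × ZMod (2 * N) → ℝ, Measurable fun z => g (torusCell N z) :=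
    fun g => (measurable_of_countable g).comp hT
  have hre : ∀ a, |(torusChar m a).re| ≤ 1 := fun a =>
    (Complex.abs_re_le_norm _).trans (norm_torusChar m a).le
  have him : ∀ a, |(torusChar m a).im| ≤ 1 := fun a =>
    (Complex.abs_im_le_norm _).trans (norm_torusChar m a).le
  obtain ⟨i1, b1⟩ := integrable_and_integral_sq_empirical_le hn hX hind
    (hm fun a => (torusChar m a).re) fun z => hre _
  obtain ⟨i2, b2⟩ := integrable_and_integral_sq_empirical_le hn hX hind
    (hm fun a => (torusChar m a).im) fun z => him _
  simp_rw [norm_sq_torusFourier_cell hn]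
  refine ⟨i1.add i2, ?_⟩
  rw [integral_add i1 i2]
  refine (add_le_add b1 b2).trans (le_of_eq ?_)
  rw [← mul_add, ← integral_add]
  · have : ∀ z : Plane, (torusChar m (torusCell N z)).re ^ 2 + (torusChar m (torusCell N z)).im ^ 2
        = 1 := fun z => by
      have := norm_torusChar m (torusCell N z)
      rw [← one_pow 2, ← this, ← Complex.normSq_eq_norm_sq, Complex.normSq_apply, sq, sq]
    simp [this]
  · exact Integrable.of_bound ((hm fun a => (torusChar m a).re ^ 2)).aestronglyMeasurable 1
      (Filter.Eventually.of_forall fun z => by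
        rw [Real.norm_eq_abs, abs_pow]; exact pow_le_one₀ (abs_nonneg _) (hre _))
  · exact Integrable.of_bound ((hm fun a => (torusChar m a).im ^ 2)).aestronglyMeasurable 1
      (Filter.Eventually.of_forall fun z => by
        rw [Real.norm_eq_abs, abs_pow]; exact pow_le_one₀ (abs_nonneg _) (him _))

/-- The bound `1 / n` is uniform in the frequency, so it factors out and leaves the trace of the
inverse Laplacian for `M = 2 N`. -/
theorem integrable_and_integral_cellEnergy_le {N : ℕ} [NeZero (2 * N)] (hn : n ≠ 0)
    (hX : ∀ i, HasLaw (X i) μ P) (hind : iIndepFun X P) :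
    Integrable (fun ω => cellEnergy N (empiricalMeasure fun i => X i ω) μ) P ∧
    ∫ ω, cellEnergy N (empiricalMeasure fun i => X i ω) μ ∂P
      ≤ (N : ℝ) ^ 2 * (5 + 3 * Real.log N) / n := by
  have h := fun m => integrable_and_integral_norm_sq_torusFourier_le (N := N) hn hX hind m
  have hint := fun m => (h m).1.div_const (torusEigenvalue m)
  unfold cellEnergy
  refine ⟨integrable_finsetSum _ fun m _ => hint m, ?_⟩
  rw [integral_finsetSum _ fun m _ => hint m]
  simp_rw [integral_div]
  calc _ ≤ ∑ m : ZMod (2 * N) × ZMod (2 * N), (n : ℝ)⁻¹ * (torusEigenvalue m)⁻¹ := by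
        refine Finset.sum_le_sum fun m _ => ?_
        rw [div_eq_mul_inv]
        exact mul_le_mul_of_nonneg_right (h m).2 (inv_nonneg.mpr (torusEigenvalue_nonneg m))
    _ ≤ (n : ℝ)⁻¹ * (((2 * N : ℕ) : ℝ) ^ 2 / 4 * (5 + 3 * Real.log (2 * N / 2 : ℕ))) := by
        rw [← Finset.mul_sum]
        gcongr
        exact sum_inv_torusEigenvalue_le
    _ = _ := by
      rw [Nat.mul_div_cancel_left N two_pos]
      push_cast
      ring

theorem lintegral_wasserstein1_le {N : ℕ} (hN : N ≠ 0) (hn : n ≠ 0)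
    (hμ : ∀ᵐ x ∂μ, x ∈ unitSquare) (hX : ∀ i, HasLaw (X i) μ P) (hind : iIndepFun X P) :
    ∫⁻ ω, wasserstein1 (empiricalMeasure fun i => X i ω) μ ∂P
      ≤ ENNReal.ofReal (√(2 * (5 + 3 * Real.log N) / n) + 2 / N) := by
  have : NeZero (2 * N) := ⟨by omega⟩
  have hN0 : (0 : ℝ) < N := by exact_mod_cast Nat.pos_of_ne_zero hN
  have hn0 : (0 : ℝ) < n := by exact_mod_cast Nat.pos_of_ne_zero hn
  have hlog : 0 ≤ Real.log N := Real.log_natCast_nonneg N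
  obtain ⟨hint, hle⟩ := integrable_and_integral_cellEnergy_le (N := N) hn hX hind
  set s := √(2 * (5 + 3 * Real.log N) / n) with hs
  have hs0 : 0 < s := Real.sqrt_pos.mpr (by positivity)
  have hs2 : s ^ 2 = 2 * (5 + 3 * Real.log N) / n := Real.sq_sqrt (by positivity)
  set Z : Ω → ℝ := fun ω =>
    2 * (1 / (N : ℝ)) ^ 2 * cellEnergy N (empiricalMeasure fun i => X i ω) μ with hZ
  have hZ0 : ∀ ω, 0 ≤ Z ω := fun ω => mul_nonneg (by positivity)
    (Finset.sum_nonneg fun m _ => div_nonneg (by positivity) (torusEigenvalue_nonneg m))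
  have hZi : Integrable Z P := hint.const_mul _
  have hZle : ∫ ω, Z ω ∂P ≤ s ^ 2 := by
    rw [hZ, integral_const_mul, hs2]
    calc _ ≤ 2 * (1 / (N : ℝ)) ^ 2 * ((N : ℝ) ^ 2 * (5 + 3 * Real.log N) / n) := by gcongr
      _ = _ := by field_simp
  have hsq : ∀ᵐ ω ∂P, ∀ i, X i ω ∈ unitSquare := by
    rw [ae_all_iff]
    intro i
    rw [← (hX i).map_eq] at hμ
    exact ae_of_ae_map (hX i).aemeasurable hμ
  -- Instead of Jensen, `√Z ≤ Z / (2 s) + s / 2` linearizes the root at the target value `s`; with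
  -- `E Z ≤ s²` the mean of the right side is at most `s`, plus the mesh term.
  have hbound : ∀ᵐ ω ∂P, wasserstein1 (empiricalMeasure fun i => X i ω) μ
      ≤ ENNReal.ofReal (Z ω / (2 * s) + s / 2 + 2 / N) := by
    filter_upwards [hsq] with ω hω
    have := isProbabilityMeasure_empiricalMeasure hn fun i => X i ω
    have hemp : ∀ᵐ x ∂(empiricalMeasure fun i => X i ω), x ∈ unitSquare := by
      rw [ae_iff]
      simp [empiricalMeasure, hω]
    refine (wasserstein1_le_sqrt_cellEnergy hN _ μ hemp hμ).trans (ENNReal.ofReal_le_ofReal ?_)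
    gcongr
    change √(Z ω) ≤ _
    have h1 : √(Z ω) * (2 * s) ≤ Z ω + s ^ 2 := by
      nlinarith [sq_nonneg (√(Z ω) - s), Real.sq_sqrt (hZ0 ω)]
    rw [← mul_le_mul_iff_left₀ (by positivity : 0 < 2 * s)]
    refine h1.trans (le_of_eq ?_)
    field_simp
  refine (lintegral_mono_ae hbound).trans ?_
  rw [← ofReal_integral_eq_lintegral_ofReal]
  · refine ENNReal.ofReal_le_ofReal ?_
    rw [integral_add, integral_add, integral_div]
    · simp only [integral_const, probReal_univ, one_smul]
      have : (∫ ω, Z ω ∂P) / (2 * s) ≤ s / 2 := by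
        rw [div_le_iff₀ (by positivity)]; nlinarith
      linarith
    · exact hZi.div_const _
    · exact integrable_const _
    · exact (hZi.div_const _).add (integrable_const _)
    · exact integrable_const _
  · exact ((hZi.div_const _).add (integrable_const _)).add (integrable_const _)
  · exact Filter.Eventually.of_forall fun ω => by
      have := hZ0 ω
      positivity

end Energy

/-! ### Choice of the mesh and conclusion. -/

theorem sqrt_add_mesh_le {n : ℕ} (hn : 2 ≤ n) :
    √(2 * (5 + 3 * Real.log (Nat.sqrt n + 1 : ℕ)) / n) + 2 / (Nat.sqrt n + 1 : ℕ)
      ≤ 10 * √(Real.log n / n) := by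
  have hn2 : (2 : ℝ) ≤ n := by exact_mod_cast hn
  have hn0 : (0 : ℝ) < n := by linarith
  -- This absorbs the additive constants: `10 + 12 log n ≤ 36 log n` and `4 ≤ 16 log n`, whence the
  -- factors `6` and `4`.
  have hlog : 1 / 2 ≤ Real.log n := by
    have := Real.log_le_log two_pos hn2
    linarith [Real.log_two_gt_d9]
  set t := √(Real.log n / n) with ht
  have ht0 : 0 ≤ t := Real.sqrt_nonneg _
  have ht2 : t ^ 2 = Real.log n / n := Real.sq_sqrt (by positivity)
  have hlogN : Real.log (Nat.sqrt n + 1 : ℕ) ≤ 2 * Real.log n := by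
    have h : Nat.sqrt n + 1 ≤ n ^ 2 := by nlinarith [Nat.sqrt_le_self n]
    have h' : ((Nat.sqrt n + 1 : ℕ) : ℝ) ≤ (n : ℝ) ^ 2 := by exact_mod_cast h
    have := Real.log_le_log (by positivity) h'
    rwa [Real.log_pow, Nat.cast_ofNat] at this
  have h1 : √(2 * (5 + 3 * Real.log (Nat.sqrt n + 1 : ℕ)) / n) ≤ 6 * t := by
    refine Real.sqrt_le_iff.mpr ⟨by positivity, ?_⟩
    rw [mul_pow, ht2, ← mul_div_assoc]
    refine div_le_div_of_nonneg_right ?_ hn0.le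
    linarith
  have h2 : 2 / ((Nat.sqrt n + 1 : ℕ) : ℝ) ≤ 4 * t := by
    refine abs_le_of_sq_le_sq' ?_ (by positivity) |>.2
    rw [mul_pow, ht2, div_pow, ← mul_div_assoc]
    have h : (n : ℝ) ≤ ((Nat.sqrt n + 1 : ℕ) : ℝ) ^ 2 := by
      have := Nat.lt_succ_sqrt n
      exact_mod_cast (by rw [sq]; exact this.le)
    gcongr
    linarith
  linarith

theorem mainTheorem4 :
    ∃ C : ℝ, 0 < C ∧
      ∀ (n : ℕ), 2 ≤ n →
      ∀ (μ : Measure Plane) [IsProbabilityMeasure μ], μ.support ⊆ unitSquare →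
      ∀ {Ω : Type*} [MeasurableSpace Ω] (P : Measure Ω) [IsProbabilityMeasure P]
        (X : Fin n → Ω → Plane),
        (∀ i, HasLaw (X i) μ P) → iIndepFun X P →
        AEMeasurable (fun ω => wasserstein1 (empiricalMeasure fun i => X i ω) μ) P ∧
        ∫⁻ ω, wasserstein1 (empiricalMeasure fun i => X i ω) μ ∂P
          ≤ ENNReal.ofReal (C * √(Real.log n / n)) := by
  refine ⟨10, by norm_num, fun n hn μ _ hsupp Ω _ P _ X hX hind => ⟨?_, ?_⟩⟩
  · exact (continuous_wasserstein1_empiricalMeasure (by omega) μ).measurable.comp_aemeasurable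
      (aemeasurable_pi_lambda _ fun i => (hX i).aemeasurable)
  · have hμ : ∀ᵐ x ∂μ, x ∈ unitSquare :=
      Filter.mem_of_superset Measure.support_mem_ae hsupp
    exact (lintegral_wasserstein1_le (Nat.succ_ne_zero (Nat.sqrt n)) (by omega) hμ hX hind).trans
      (ENNReal.ofReal_le_ofReal (sqrt_add_mesh_le hn))
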